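/- Let $(P_\theta)_{\theta\in\Theta}$ be a statistical model, let $H_{0,1},\dots,H_{0,n}\subseteq\Theta$ be null hypotheses, and let $U\sim\mathrm{Unif}([0,1])$. A random variable $p\in[0,1]$ is a \emph{selectively dominant p-value} for $H_0\subseteq\Theta$ if, for every $\theta\in H_0$: $P_\theta(p\le t)\le t$ for all $t\in[0,1]$; $p$ has a probability density under $P_\theta$; and for every measurable selection function $s:\mathbb{R}\to[0,1]$ and all $t\in[0,1]$, $$P_\theta(p\le t\mid S=1)\le P(U\le t\mid S'=1),$$ where $S,S'\in\{0,1\}$ satisfy $P_\theta(S=1\mid p=x)=s(x)=P(S'=1\mid U=x)$, and a probability conditional on an event of probability zero is set to $0$. Suppose that $p_1,\dots,p_n$ are independent under every $P_\theta$, that each $p_i$ is a selectively dominant p-value for $H_{0,i}$, and fix $\alpha\in(0,1)$ and thresholds $\tau_1,\dots,\tau_n\in[0,1]$. Let $J=\{j : p_j\le\tau_j\}$ be the random set of selected indices. Consider the test that rejects when $J\neq\emptyset$ and $$-2\sum_{j\in J}\log(p_j/\tau_j)\ \ge\ \mathrm{Quantile}(1-\alpha,\chi^2_{2|J|}),$$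 where the left-hand side is read as $+\infty$ if $p_j=0$ for some $j\in J$ (when $J=\emptyset$ nothing is tested or rejected). Then rejecting the data-dependent null $\bigcap_{j\in J}H_{0,j}$ with this test controls Type I error at level $\alpha$ conditionally on $J$, and therefore also marginally: for every $\theta\in\Theta$ and every $I\subseteq\{1,\dots,n\}$ with $P_\theta(J=I)>0$, $$P_\theta\Big(\text{the test rejects and }\theta\in\bigcap_{j\in J}H_{0,j}\ \Big|\ J=I\Big)\le\alpha,$$ and the same bound holds without the conditioning. The same is true of rejecting the global null with this test: for every $\theta\in\bigcap_{i=1}^nH_{0,i}$ and every such $I$, $P_\theta(\text{the test rejects}\mid J=I)\le\alpha$ and $P_\theta(\text{the test rejects})\le\alpha$. -/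

import Mathlib

open MeasureTheory ProbabilityTheory
open scoped ENNReal

noncomputable section

/-- The joint law on `ℝ × Bool` of a pair `(X, S)`, where `X` has law `μ` and, given `X = x`, the
selection indicator `S` is `true` with probability `s x` and `false` with probability `1 - s x`. -/
def selectionLaw (μ : Measure ℝ) (s : ℝ → ℝ) : Measure (ℝ × Bool) :=
  (μ.withDensity fun x => ENNReal.ofReal (s x)).map (fun x => (x, true)) +
    (μ.withDensity fun x => ENNReal.ofReal (1 - s x)).map (fun x => (x, false))

/-- `P(X ≤ t | S = 1)` for the pair `(X, S)` with law `selectionLaw μ s`; it is `0` if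
`P(S = 1) = 0`. -/
def selectedCDF (μ : Measure ℝ) (s : ℝ → ℝ) (t : ℝ) : ℝ≥0∞ :=
  cond (selectionLaw μ s) {q | q.2 = true} {q | q.1 ≤ t}

/-- The uniform distribution on `[0, 1]`. -/
def unif01 : Measure ℝ := volume.restrict (Set.Icc 0 1)

/-- `p` is a (valid) p-value for the null hypothesis `H` in the statistical model `P`: a random
variable with values in `[0, 1]` whose law stochastically dominates the uniform distribution under
every distribution of the null. -/
structure IsPValue {Θ Ω : Type*} [MeasurableSpace Ω] (P : Θ → Measure Ω) (H : Set Θ)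
    (p : Ω → ℝ) : Prop where
  measurable : Measurable p
  mem_Icc : ∀ ω, p ω ∈ Set.Icc (0 : ℝ) 1
  valid : ∀ θ ∈ H, ∀ t ∈ Set.Icc (0 : ℝ) 1, P θ {ω | p ω ≤ t} ≤ ENNReal.ofReal t

/-- `p` is a selectively dominant p-value for the null hypothesis `H`: under every distribution of
the null it has a probability density and, for every selection function `s`, its law given selection
stochastically dominates the law of a uniform variable given the same selection. -/
structure IsSelectivelyDominant {Θ Ω : Type*} [MeasurableSpace Ω] (P : Θ → Measure Ω) (H : Set Θ)
    (p : Ω → ℝ) : Prop extends IsPValue P H p where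
  hasPDF : ∀ θ ∈ H, HasPDF p (P θ) volume
  dominates : ∀ θ ∈ H, ∀ s : ℝ → ℝ, Measurable s → (∀ x, s x ∈ Set.Icc (0 : ℝ) 1) →
    ∀ t ∈ Set.Icc (0 : ℝ) 1, selectedCDF ((P θ).map p) s t ≤ selectedCDF unif01 s t

/-- The chi-squared distribution with `d` degrees of freedom: the Gamma distribution with shape
`d / 2` and rate `1 / 2`, which for `d = 0` degenerates to the point mass at `0`. -/
def chiSquared (d : ℕ) : Measure ℝ :=
  if d = 0 then Measure.dirac 0 else gammaMeasure ((d : ℝ) / 2) (1 / 2)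

/-- The `q`-quantile of a probability measure on `ℝ`, for `0 < q < 1`. -/
def quantile (q : ℝ) (μ : Measure ℝ) : ℝ :=
  sInf {x | q ≤ (μ (Set.Iic x)).toReal}

/-- The set `J` of the indices `j` with `x j ≤ τ j`. -/
def selectedIndices {n : ℕ} (τ x : Fin n → ℝ) : Finset (Fin n) := by
  classical exact Finset.univ.filter fun j => x j ≤ τ j

/-- The statistic `-2 ∑_{j ∈ J} log (x j / τ j)`, with value `+∞` if some `x j` with `j ∈ J` is `0`
(`ENNReal.log` is the logarithm with `log 0 = -∞`). -/
def truncatedFisherStat {n : ℕ} (τ x : Fin n → ℝ) : EReal :=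
  -2 * ∑ j ∈ selectedIndices τ x, ENNReal.log (ENNReal.ofReal (x j / τ j))

/-- The truncated Fisher test at level `α` rejects for the p-values `x`. When no p-value is
selected, no hypothesis is tested and nothing is rejected. -/
def TruncatedFisherRejects {n : ℕ} (α : ℝ) (τ x : Fin n → ℝ) : Prop :=
  (selectedIndices τ x).Nonempty ∧
    ((quantile (1 - α) (chiSquared (2 * (selectedIndices τ x).card)) : ℝ) : EReal) ≤
      truncatedFisherStat τ x

end

/-! The event `J = I` is an intersection of events `p i ≤ τ i` (for `i ∈ I`) and `τ i < p i` (for `i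
∉ I`), each involving a single p-value. Conditioning on it therefore preserves independence, and the
conditional law of `p i`, `i ∈ I`, is its law given `p i ≤ τ i`. Selective dominance for the
selection function `1_{x ≤ τ i}` compares this law with a uniform variable truncated at `τ i`. Hence
`p i / τ i` is stochastically at least uniform and `-2 log (p i / τ i)` has tails below those of
`χ²₂` (`cond_log_ge_le`). Tail domination survives convolution, so the sum over `I` is dominated by
`χ²` with `2|I|` degrees of freedom (`measure_sum_ge_le_chiSquared`), whose quantile gives level
`α`. Averaging over `I` gives the marginal bounds. -/

/-! ### Convolutions and tails -/

/-- If the tails of `μ₁` and `μ₂` are bounded by those of `γ₁` and `γ₂`, then so is the tail of the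
convolution. -/
lemma conv_Ici_le_of_forall_Ici_le {μ₁ μ₂ γ₁ γ₂ : Measure ℝ} [SFinite μ₁] [SFinite μ₂]
    [SFinite γ₁] [SFinite γ₂] (h₁ : ∀ c, μ₁ (Set.Ici c) ≤ γ₁ (Set.Ici c))
    (h₂ : ∀ c, μ₂ (Set.Ici c) ≤ γ₂ (Set.Ici c)) (c : ℝ) :
    (μ₁ ∗ μ₂) (Set.Ici c) ≤ (γ₁ ∗ γ₂) (Set.Ici c) := by
  have key : ∀ ρ σ : Measure ℝ, [SFinite ρ] → [SFinite σ] →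
      (ρ ∗ σ) (Set.Ici c) = ∫⁻ x, σ (Set.Ici (c - x)) ∂ρ := by
    intro ρ σ _ _
    rw [Measure.conv, Measure.map_apply (by fun_prop) measurableSet_Ici,
      Measure.prod_apply ((by fun_prop : Measurable fun q : ℝ × ℝ => q.1 + q.2) measurableSet_Ici)]
    refine lintegral_congr fun x => congrArg σ ?_
    ext y
    simp [add_comm]
  -- One factor is replaced at a time; commutativity brings the other one inside the integral.
  calc (μ₁ ∗ μ₂) (Set.Ici c) = ∫⁻ x, μ₂ (Set.Ici (c - x)) ∂μ₁ := key _ _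
    _ ≤ ∫⁻ x, γ₂ (Set.Ici (c - x)) ∂μ₁ := lintegral_mono fun x => h₂ _
    _ = (γ₂ ∗ μ₁) (Set.Ici c) := by rw [← key, Measure.conv_comm]
    _ = ∫⁻ x, μ₁ (Set.Ici (c - x)) ∂γ₂ := key _ _
    _ ≤ ∫⁻ x, γ₁ (Set.Ici (c - x)) ∂γ₂ := lintegral_mono fun x => h₁ _
    _ = (γ₁ ∗ γ₂) (Set.Ici c) := by rw [← key, Measure.conv_comm]

/-- When the second shape is `1`, the exponentials multiply to `exp (-r x)`, constant in `y`. What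
remains is `∫₀ˣ y ^ (a - 1) = x ^ a / a`, and `Γ(a + 1) = a Γ(a)`, so no Beta integral is needed. -/
lemma lconvolution_gammaPDF_one {a r : ℝ} (ha : 0 < a) (hr : 0 < r) (x : ℝ) :
    ∫⁻ y, gammaPDF a r y * gammaPDF 1 r (-y + x) = gammaPDF (a + 1) r x := by
  have hsupp : ∀ y, gammaPDF a r y * gammaPDF 1 r (-y + x) =
      (Set.Icc 0 x).indicator (fun y => ENNReal.ofReal
        (r ^ (a + 1) / Real.Gamma a * Real.exp (-(r * x)) * y ^ (a - 1))) y := by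
    intro y
    by_cases hy : y ∈ Set.Icc 0 x
    · rw [Set.indicator_of_mem hy, gammaPDF_of_nonneg hy.1,
        gammaPDF_of_nonneg (by linarith [hy.2]), ← ENNReal.ofReal_mul]
      · congr 1
        have : Real.exp (-(r * x)) = Real.exp (-(r * y)) * Real.exp (-(r * (-y + x))) := by
          rw [← Real.exp_add]; ring_nf
        rw [this, Real.rpow_add hr]
        simp
        ring
      · have := hy.1
        have := Real.Gamma_pos_of_pos ha
        positivity
    · rw [Set.indicator_of_notMem hy]
      rcases lt_or_ge y 0 with h | h
      · rw [gammaPDF_of_neg h, zero_mul]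
      · rw [gammaPDF_of_neg (x := -y + x), mul_zero]
        by_contra hx
        exact hy ⟨h, by linarith⟩
  rw [lintegral_congr hsupp, lintegral_indicator measurableSet_Icc]
  rcases lt_or_ge x 0 with hx | hx
  · rw [Set.Icc_eq_empty (not_le.2 hx), gammaPDF_of_neg hx]
    simp
  have hint : IntervalIntegrable (fun y : ℝ => y ^ (a - 1)) volume 0 x :=
    intervalIntegral.intervalIntegrable_rpow' (by linarith)
  have hG := Real.Gamma_pos_of_pos ha
  rw [gammaPDF_of_nonneg hx, ← Measure.restrict_congr_set Ioc_ae_eq_Icc, ← ofReal_integral_eq_lintegral_ofReal]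
  · congr 1
    rw [integral_const_mul, ← intervalIntegral.integral_of_le hx,
      integral_rpow (Or.inl (by linarith)), Real.Gamma_add_one ha.ne']
    simp only [sub_add_cancel, add_sub_cancel_right]
    rw [Real.zero_rpow ha.ne']
    field_simp
    ring
  · exact ((intervalIntegrable_iff_integrableOn_Ioc_of_le hx).1 hint).const_mul _
  · refine (ae_restrict_iff' measurableSet_Ioc).2 (ae_of_all _ fun y hy => ?_)
    have := hy.1
    positivity

lemma gammaMeasure_conv_gammaMeasure_one {a r : ℝ} (ha : 0 < a) (hr : 0 < r) :
    gammaMeasure a r ∗ gammaMeasure 1 r = gammaMeasure (a + 1) r := by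
  have hm : ∀ b, Measurable (gammaPDF b r) := fun b =>
    (measurable_gammaPDFReal b r).ennreal_ofReal
  have : SFinite (gammaMeasure 1 r) :=
    (have := isProbabilityMeasure_gammaMeasure one_pos hr; inferInstance)
  rw [gammaMeasure, gammaMeasure, conv_withDensity_eq_lconvolution (hm _) (hm _),
    gammaMeasure]
  congr 1
  ext x
  exact lconvolution_gammaPDF_one ha hr x

/-! ### Chi-squared distributions -/

lemma chiSquared_two_mul_succ (k : ℕ) :
    chiSquared (2 * (k + 1)) = gammaMeasure ((k : ℝ) + 1) (1 / 2) := by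
  rw [chiSquared, if_neg (by omega)]
  congr 1
  push_cast
  ring

instance (d : ℕ) : IsProbabilityMeasure (chiSquared d) := by
  unfold chiSquared
  split_ifs with h
  · infer_instance
  · have : 0 < d := Nat.pos_of_ne_zero h
    exact isProbabilityMeasure_gammaMeasure (by positivity) (by norm_num)

lemma chiSquared_conv_chiSquared_two (k : ℕ) :
    chiSquared (2 * k) ∗ chiSquared 2 = chiSquared (2 * (k + 1)) := by
  have h2 : chiSquared 2 = gammaMeasure 1 (1 / 2) := by
    simpa using chiSquared_two_mul_succ 0
  cases k with
  -- The convention that `χ²₀` is the point mass at `0` makes it the neutral element of convolution.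
  | zero =>
    have h0 : chiSquared (2 * 0) = Measure.dirac 0 := if_pos rfl
    rw [h0, Measure.dirac_zero_conv]
  | succ k =>
    rw [chiSquared_two_mul_succ, chiSquared_two_mul_succ, h2,
      gammaMeasure_conv_gammaMeasure_one (by positivity) (by norm_num)]
    push_cast
    rfl

lemma chiSquared_singleton {d : ℕ} (hd : d ≠ 0) (x : ℝ) : chiSquared d {x} = 0 := by
  rw [chiSquared, if_neg hd]
  exact withDensity_absolutelyContinuous _ _ (Real.volume_singleton)

lemma chiSquared_two_Ici {c : ℝ} (hc : 0 ≤ c) :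
    chiSquared 2 (Set.Ici c) = ENNReal.ofReal (Real.exp (-c / 2)) := by
  have h2 : chiSquared 2 = expMeasure (1 / 2) := by
    simpa [expMeasure] using chiSquared_two_mul_succ 0
  have hI : chiSquared 2 (Set.Ici c) = chiSquared 2 (Set.Ioi c) :=
    (measure_congr (Ioi_ae_eq_Ici' (chiSquared_singleton two_ne_zero c))).symm
  have hexp : Real.exp (-(1 / 2 * c)) = Real.exp (-c / 2) := by ring_nf
  have hle : Real.exp (-c / 2) ≤ 1 := Real.exp_le_one_iff.2 (by linarith)
  rw [hI, ← Set.compl_Iic, prob_compl_eq_one_sub measurableSet_Iic, ← ofReal_cdf, h2,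
    cdf_expMeasure_eq (by norm_num), if_pos hc, ← ENNReal.ofReal_one,
    ← ENNReal.ofReal_sub _ (by rw [hexp]; linarith), hexp, sub_sub_cancel]

lemma chiSquared_two_Ici_of_nonpos {c : ℝ} (hc : c ≤ 0) : chiSquared 2 (Set.Ici c) = 1 := by
  refine le_antisymm prob_le_one ?_
  calc (1 : ℝ≥0∞) = chiSquared 2 (Set.Ici 0) := by rw [chiSquared_two_Ici le_rfl]; simp
    _ ≤ _ := measure_mono (Set.Ici_subset_Ici.2 hc)

/-- Tail bound for a sum of independent variables that are each dominated by `χ²` with two degrees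
of freedom. -/
lemma measure_sum_ge_le_chiSquared {Ω ι : Type*} [MeasurableSpace Ω] {ν : Measure Ω}
    {E : ι → Ω → ℝ} (hE : ∀ i, Measurable (E i)) (hind : iIndepFun E ν) (I : Finset ι)
    (htail : ∀ i ∈ I, ∀ c, ν {ω | c ≤ E i ω} ≤ chiSquared 2 (Set.Ici c)) (c : ℝ) :
    ν {ω | c ≤ ∑ i ∈ I, E i ω} ≤ chiSquared (2 * I.card) (Set.Ici c) := by
  classical
  have := hind.isProbabilityMeasure
  induction I using Finset.induction_on generalizing c with
  | empty =>
    by_cases hc : c ≤ 0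
    · simp [chiSquared, hc]
    · simp [chiSquared, hc]
  | insert i I hi ih =>
    have hsum : Measurable (∑ j ∈ I, E j) := by fun_prop
    have hmap := (hind.indepFun_finsetSum_of_notMem hE hi).map_add_eq_map_conv_map hsum (hE i)
    have hev : {ω | c ≤ ∑ j ∈ insert i I, E j ω} = (∑ j ∈ I, E j + E i) ⁻¹' Set.Ici c := by
      ext ω
      simp [Finset.sum_insert hi, add_comm]
    rw [hev, ← Measure.map_apply (hsum.add (hE i)) measurableSet_Ici, hmap,
      Finset.card_insert_of_notMem hi, ← chiSquared_conv_chiSquared_two]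
    have := Measure.isProbabilityMeasure_map (μ := ν) hsum.aemeasurable
    have := Measure.isProbabilityMeasure_map (μ := ν) (hE i).aemeasurable
    refine conv_Ici_le_of_forall_Ici_le (fun c => ?_) (fun c => ?_) c
    · rw [Measure.map_apply hsum measurableSet_Ici]
      simpa [Set.preimage] using ih (fun j hj => htail j (Finset.mem_insert_of_mem hj)) c
    · rw [Measure.map_apply (hE i) measurableSet_Ici]
      exact htail i (Finset.mem_insert_self i I) c

/-! ### Quantiles -/

/-- Right continuity of the cdf makes the infimum defining the quantile attained. Absence of atoms
lets the closed tail, which is the rejection region, be replaced by the open one. -/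
lemma measure_Ici_quantile_le {μ : Measure ℝ} [IsProbabilityMeasure μ] (hμ : ∀ x, μ {x} = 0)
    {α : ℝ} (hα : α ∈ Set.Ioo (0 : ℝ) 1) :
    μ (Set.Ici (quantile (1 - α) μ)) ≤ ENNReal.ofReal α := by
  set q := quantile (1 - α) μ with hq
  have hS : {x | 1 - α ≤ (μ (Set.Iic x)).toReal} = {x | 1 - α ≤ cdf μ x} := by
    ext x
    rw [Set.mem_ofPred_eq, Set.mem_ofPred_eq, cdf_eq_real, measureReal_def]
  have hne : {x | 1 - α ≤ cdf μ x}.Nonempty :=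
    ((tendsto_cdf_atTop μ).eventually (eventually_ge_nhds (by linarith [hα.1]))).exists
  have hge : 1 - α ≤ cdf μ q := by
    have hright : Filter.Tendsto (cdf μ) (nhdsWithin q (Set.Ioi q)) (nhds (cdf μ q)) :=
      ((cdf μ).right_continuous q).mono_left (nhdsWithin_mono _ Set.Ioi_subset_Ici_self)
    refine ge_of_tendsto hright (eventually_nhdsWithin_of_forall fun x hx => ?_)
    rw [hq, quantile, hS] at hx
    obtain ⟨y, hy, hyx⟩ := exists_lt_of_csInf_lt hne hx
    exact hy.trans (monotone_cdf μ hyx.le)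
  rw [← measure_congr (Ioi_ae_eq_Ici' (hμ q)), ← Set.compl_Iic,
    prob_compl_eq_one_sub measurableSet_Iic, ← ofReal_cdf, ← ENNReal.ofReal_one,
    ← ENNReal.ofReal_sub _ (cdf_nonneg μ _)]
  exact ENNReal.ofReal_le_ofReal (by linarith)

/-! ### Selection by truncation -/

lemma selectionLaw_selected_inter (μ : Measure ℝ) {s : ℝ → ℝ} {A : Set ℝ} (hA : MeasurableSet A) :
    selectionLaw μ s ({q | q.2 = true} ∩ {q | q.1 ∈ A}) =
      (μ.withDensity fun x => ENNReal.ofReal (s x)) A := by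
  have hm : MeasurableSet ({q : ℝ × Bool | q.2 = true} ∩ {q | q.1 ∈ A}) :=
    (measurable_snd (MeasurableSet.singleton true)).inter (measurable_fst hA)
  rw [selectionLaw, Measure.add_apply, Measure.map_apply (by fun_prop) hm,
    Measure.map_apply (by fun_prop) hm]
  simp

/-- An indicator as selection function makes selection deterministic, so it amounts to conditioning
on an event. -/
lemma selectedCDF_indicator_Iic (μ : Measure ℝ) (τ t : ℝ) :
    selectedCDF μ ((Set.Iic τ).indicator 1) t = cond μ (Set.Iic τ) (Set.Iic t) := by
  have hd : (μ.withDensity fun x => ENNReal.ofReal ((Set.Iic τ).indicator (1 : ℝ → ℝ) x)) =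
      μ.restrict (Set.Iic τ) := by
    rw [← withDensity_indicator_one measurableSet_Iic]
    congr 1
    ext x
    by_cases hx : x ∈ Set.Iic τ <;> simp [hx]
  have h₁ := selectionLaw_selected_inter μ (s := (Set.Iic τ).indicator 1) MeasurableSet.univ
  have h₂ := selectionLaw_selected_inter μ (s := (Set.Iic τ).indicator 1)
    (measurableSet_Iic (a := t))
  rw [hd, Measure.restrict_apply MeasurableSet.univ] at h₁
  rw [hd, Measure.restrict_apply measurableSet_Iic, Set.inter_comm (Set.Iic t)] at h₂
  simp only [Set.mem_univ, Set.ofPred_true, Set.inter_univ, Set.univ_inter, Set.mem_Iic] at h₁ h₂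
  have hm : MeasurableSet {q : ℝ × Bool | q.2 = true} :=
    measurable_snd (MeasurableSet.singleton true)
  rw [selectedCDF, cond_apply hm,
    cond_apply measurableSet_Iic, h₂, h₁]

lemma unif01_Iic {t : ℝ} (ht : t ∈ Set.Icc (0 : ℝ) 1) : unif01 (Set.Iic t) = ENNReal.ofReal t := by
  have : Set.Iic t ∩ Set.Icc 0 1 = Set.Icc 0 t := by
    ext x
    simp only [Set.mem_inter_iff, Set.mem_Iic, Set.mem_Icc]
    exact ⟨fun h => ⟨h.2.1, h.1⟩, fun h => ⟨h.2, h.1, h.2.trans ht.2⟩⟩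
  rw [unif01, Measure.restrict_apply measurableSet_Iic, this, Real.volume_Icc, sub_zero]

namespace IsSelectivelyDominant

variable {Θ Ω : Type*} [MeasurableSpace Ω] {P : Θ → Measure Ω} {H : Set Θ} {p : Ω → ℝ}

/-- Given `p ≤ τ`, the ratio `p / τ` is again stochastically larger than a uniform variable. -/
lemma cond_le_ofReal (h : IsSelectivelyDominant P H p) {θ : Θ} (hθ : θ ∈ H) {τ u : ℝ}
    (hτ : τ ∈ Set.Ioc (0 : ℝ) 1) (hu : u ∈ Set.Icc (0 : ℝ) 1) :
    cond (P θ) (p ⁻¹' Set.Iic τ) {ω | p ω ≤ τ * u} ≤ ENNReal.ofReal u := by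
  have hle : τ * u ≤ τ := mul_le_of_le_one_right hτ.1.le hu.2
  have hmem : τ * u ∈ Set.Icc (0 : ℝ) 1 :=
    ⟨mul_nonneg hτ.1.le hu.1, hle.trans hτ.2⟩
  have hdom := h.dominates θ hθ ((Set.Iic τ).indicator 1)
    (measurable_one.indicator measurableSet_Iic)
    (fun x => by by_cases hx : x ∈ Set.Iic τ <;> simp [hx]) (τ * u) hmem
  rw [selectedCDF_indicator_Iic, selectedCDF_indicator_Iic, cond_apply measurableSet_Iic,
    cond_apply measurableSet_Iic, Set.Iic_inter_Iic, min_eq_right hle, unif01_Iic hmem,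
    unif01_Iic ⟨hτ.1.le, hτ.2⟩, Measure.map_apply h.measurable measurableSet_Iic,
    Measure.map_apply h.measurable measurableSet_Iic] at hdom
  rw [cond_apply (h.measurable measurableSet_Iic)]
  have hinter : p ⁻¹' Set.Iic τ ∩ {ω | p ω ≤ τ * u} = p ⁻¹' Set.Iic (τ * u) := by
    ext ω
    simp only [Set.mem_inter_iff, Set.mem_preimage, Set.mem_Iic, Set.mem_ofPred_eq]
    exact ⟨fun h => h.2, fun h => ⟨h.trans hle, h⟩⟩
  rw [hinter]
  refine hdom.trans_eq ?_
  rw [ENNReal.ofReal_mul hτ.1.le, ← mul_assoc,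
    ENNReal.inv_mul_cancel (by simpa using hτ.1) ENNReal.ofReal_ne_top, one_mul]

lemma ae_pos (h : IsSelectivelyDominant P H p) {θ : Θ} (hθ : θ ∈ H) : ∀ᵐ ω ∂P θ, 0 < p ω := by
  rw [ae_iff]
  have := h.valid θ hθ 0 ⟨le_rfl, zero_le_one⟩
  simpa using this

/-- Given `p ≤ τ`, the statistic `-2 log (p / τ)` is dominated by `χ²` with two degrees of
freedom. -/
lemma cond_log_ge_le (h : IsSelectivelyDominant P H p) {θ : Θ}
    (hθ : θ ∈ H) {τ : ℝ} (hτ : τ ∈ Set.Ioc (0 : ℝ) 1) (c : ℝ) :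
    cond (P θ) (p ⁻¹' Set.Iic τ) {ω | c ≤ -2 * Real.log (p ω / τ)} ≤
      chiSquared 2 (Set.Ici c) := by
  rcases le_or_gt c 0 with hc | hc
  · rw [chiSquared_two_Ici_of_nonpos hc]
    exact prob_le_one
  rw [chiSquared_two_Ici hc.le]
  refine (measure_mono fun ω hω => ?_).trans (h.cond_le_ofReal hθ hτ
    ⟨(Real.exp_pos _).le, Real.exp_le_one_iff.2 (by linarith)⟩)
  have hω' : c ≤ -2 * Real.log (p ω / τ) := hω
  have hp : 0 ≤ p ω / τ := div_nonneg (h.mem_Icc ω).1 hτ.1.le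
  -- The value `0` is treated apart because `Real.log 0 = 0`.
  have : p ω / τ ≤ Real.exp (-c / 2) := by
    rcases hp.eq_or_lt with h0 | h0
    · rw [← h0]; exact (Real.exp_pos _).le
    · rw [← Real.exp_log h0]
      exact Real.exp_le_exp.2 (by linarith)
  rw [div_le_iff₀ hτ.1] at this
  simpa [mul_comm] using this

end IsSelectivelyDominant

/-! ### The truncated Fisher test -/

lemma mem_selectedIndices {n : ℕ} {τ x : Fin n → ℝ} {j : Fin n} :
    j ∈ selectedIndices τ x ↔ x j ≤ τ j := by
  simp [selectedIndices]

lemma setOf_selectedIndices_eq {Ω : Type*} {n : ℕ} (τ : Fin n → ℝ) (p : Fin n → Ω → ℝ)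
    (I : Finset (Fin n)) :
    {ω | selectedIndices τ (fun i => p i ω) = I} =
      ⋂ i, p i ⁻¹' (if i ∈ I then Set.Iic (τ i) else Set.Ioi (τ i)) := by
  ext ω
  simp only [Set.mem_ofPred_eq, Finset.ext_iff, mem_selectedIndices, Set.mem_iInter,
    Set.mem_preimage]
  refine forall_congr' fun i => ?_
  by_cases hi : i ∈ I <;> simp [hi]

/-- If all selected p-values are positive, the truncated Fisher statistic is a real sum. -/
lemma truncatedFisherStat_of_pos {n : ℕ} {τ x : Fin n → ℝ}
    (hx : ∀ j ∈ selectedIndices τ x, 0 < x j) :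
    truncatedFisherStat τ x =
      ((∑ j ∈ selectedIndices τ x, -2 * Real.log (x j / τ j) : ℝ) : EReal) := by
  -- The two logarithms differ at `0`. Here `0 < x j ≤ τ j` makes the ratio positive.
  have hlog : ∀ j ∈ selectedIndices τ x,
      ENNReal.log (ENNReal.ofReal (x j / τ j)) = ((Real.log (x j / τ j) : ℝ) : EReal) :=
    fun j hj => ENNReal.log_ofReal_of_pos
      (div_pos (hx j hj) ((hx j hj).trans_le (mem_selectedIndices.1 hj)))
  have hcoe : ∀ (s : Finset (Fin n)) (f : Fin n → ℝ),
      ∑ j ∈ s, ((f j : ℝ) : EReal) = ((∑ j ∈ s, f j : ℝ) : EReal) := by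
    intro s f
    classical
    induction s using Finset.induction_on with
    | empty => simp
    | insert a s ha ih => rw [Finset.sum_insert ha, Finset.sum_insert ha, ih, EReal.coe_add]
  rw [truncatedFisherStat, Finset.sum_congr rfl hlog, hcoe, ← Finset.mul_sum, EReal.coe_mul]
  rfl

lemma cond_truncatedFisherRejects_le {Θ Ω : Type*} [MeasurableSpace Ω] {P : Θ → Measure Ω}
    {n : ℕ} {H : Fin n → Set Θ} {p : Fin n → Ω → ℝ}
    (hdom : ∀ i, IsSelectivelyDominant P (H i) (p i)) {θ : Θ} (hindep : iIndepFun p (P θ))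
    {τ : Fin n → ℝ} (hτ : ∀ i, τ i ∈ Set.Icc (0 : ℝ) 1) {α : ℝ} (hα : α ∈ Set.Ioo (0 : ℝ) 1)
    {I : Finset (Fin n)} (hθ : ∀ i ∈ I, θ ∈ H i) :
    cond (P θ) {ω | selectedIndices τ (fun i => p i ω) = I}
      {ω | TruncatedFisherRejects α τ (fun i => p i ω)} ≤ ENNReal.ofReal α := by
  have := hindep.isProbabilityMeasure
  have hp : ∀ i, Measurable (p i) := fun i => (hdom i).measurable
  set t : Fin n → Set ℝ := fun i => if i ∈ I then Set.Iic (τ i) else Set.Ioi (τ i) with ht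
  have htm : ∀ i, MeasurableSet (t i) := fun i => by
    by_cases hi : i ∈ I <;> simp [ht, hi]
  have hJm : MeasurableSet {ω | selectedIndices τ (fun i => p i ω) = I} := by
    rw [setOf_selectedIndices_eq]
    exact .iInter fun i => hp i (htm i)
  by_cases hzero : P θ {ω | selectedIndices τ (fun i => p i ω) = I} = 0
  · simp [cond_eq_zero_of_meas_eq_zero hzero]
  have hae : ∀ᵐ ω ∂(P θ)[|{ω | selectedIndices τ (fun i => p i ω) = I}],
      selectedIndices τ (fun i => p i ω) = I := ae_cond_mem hJm
  have hpos : ∀ᵐ ω ∂(P θ)[|{ω | selectedIndices τ (fun i => p i ω) = I}], ∀ i ∈ I, 0 < p i ω := by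
    refine cond_absolutelyContinuous.ae_le ?_
    exact (Filter.eventually_all_finset I).2 fun i hi => (hdom i).ae_pos (hθ i hi)
  -- The quantile bound fails for the atom `χ²₀`; an empty selection is instead settled by the test
  -- never rejecting.
  rcases I.eq_empty_or_nonempty with rfl | hI
  · refine (measure_mono_null_ae (t := ∅) ?_ measure_empty).trans_le zero_le
    filter_upwards [hae] with ω hω hrej
    have hne : (selectedIndices τ fun i => p i ω).Nonempty := hrej.1
    rw [hω] at hne
    exact Finset.not_nonempty_empty hne
  -- The conditioning variables and the variables of interest coincide, hence the doubled pair.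
  have hpair : iIndepFun (fun i ω => (p i ω, p i ω)) (P θ) :=
    hindep.comp (fun _ x => (x, x)) fun _ => by fun_prop
  have ht0 : ∀ i, P θ (p i ⁻¹' t i) ≠ 0 := fun i h0 => hzero <| by
    rw [setOf_selectedIndices_eq]
    exact measure_mono_null (Set.iInter_subset _ i) h0
  -- If `τ i = 0`, selecting `i` would require `p i ≤ 0`, a null event, whereas `J = I` has positive
  -- probability.
  have hτpos : ∀ i ∈ I, τ i ∈ Set.Ioc (0 : ℝ) 1 := fun i hi => by
    refine ⟨(hτ i).1.lt_of_ne fun h0 => ht0 i ?_, (hτ i).2⟩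
    have := (hdom i).ae_pos (hθ i hi)
    rw [ae_iff] at this
    simpa [ht, hi, ← h0, Set.preimage] using this
  have hmeas : ∀ i, Measurable fun x : ℝ => -2 * Real.log (x / τ i) := fun i => by fun_prop
  have hindE : iIndepFun (fun i ω => -2 * Real.log (p i ω / τ i))
      ((P θ)[|{ω | selectedIndices τ (fun i => p i ω) = I}]) := by
    rw [setOf_selectedIndices_eq]
    exact (iIndepFun.cond hp hpair ht0 htm).comp _ hmeas
  have htail : ∀ i ∈ I, ∀ c, (P θ)[|{ω | selectedIndices τ (fun i => p i ω) = I}]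
      {ω | c ≤ -2 * Real.log (p i ω / τ i)} ≤ chiSquared 2 (Set.Ici c) := by
    intro i hi c
    -- With a single index, the product formula says that only the condition on `p i` affects its
    -- law.
    have hc := cond_iInter (s := {i}) (f := fun j => {ω | c ≤ -2 * Real.log (p j ω / τ j)})
      hp hpair (fun j _ => ⟨_, hmeas j measurableSet_Ici, rfl⟩) (fun j _ => ht0 j) htm
    simp only [Finset.mem_singleton, Set.iInter_iInter_eq_left, Finset.prod_singleton] at hc
    rw [setOf_selectedIndices_eq, hc]
    have hti : t i = Set.Iic (τ i) := if_pos hi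
    rw [hti]
    exact (hdom i).cond_log_ge_le (hθ i hi) (hτpos i hi) c
  have hd : 2 * I.card ≠ 0 := by have := hI.card_pos; omega
  refine (measure_mono_ae ?_).trans
    ((measure_sum_ge_le_chiSquared (fun i => (hmeas i).comp (hp i)) hindE I htail _).trans
      (measure_Ici_quantile_le (chiSquared_singleton hd) hα))
  filter_upwards [hae, hpos] with ω hω hω' hrej
  have hrej' := hrej.2
  rw [truncatedFisherStat_of_pos (by rw [hω]; exact hω'), hω, EReal.coe_le_coe_iff] at hrej'
  exact hrej'

/-- A bound on all conditional probabilities given a finitely valued variable is a bound on the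
probability. -/
lemma measure_le_of_forall_cond_le {Ω β : Type*} [MeasurableSpace Ω] [Finite β] {μ : Measure Ω}
    [IsProbabilityMeasure μ] {J : Ω → β} (hJ : ∀ b, MeasurableSet {ω | J ω = b}) {A : Set Ω}
    {c : ℝ≥0∞} (h : ∀ b, cond μ {ω | J ω = b} A ≤ c) : μ A ≤ c := by
  have := Fintype.ofFinite β
  have htot : ∑ b, μ {ω | J ω = b} = 1 := by
    rw [← tsum_fintype (L := .unconditional _), ← measure_iUnion _ hJ]
    · rw [← measure_univ (μ := μ)]
      congr 1
      ext ω
      simp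
    · intro a b hab
      exact Set.disjoint_left.2 fun ω ha hb => hab (ha.symm.trans hb)
  calc μ A ≤ μ (⋃ b, {ω | J ω = b} ∩ A) := measure_mono fun ω hω => by simpa using hω
    _ ≤ ∑ b, μ ({ω | J ω = b} ∩ A) := measure_iUnion_fintype_le _ _
    _ = ∑ b, cond μ {ω | J ω = b} A * μ {ω | J ω = b} :=
      Finset.sum_congr rfl fun b _ => (cond_mul_eq_inter (hJ b) A μ).symm
    _ ≤ ∑ b, c * μ {ω | J ω = b} := Finset.sum_le_sum fun b _ => by gcongr; exact h b
    _ = c := by rw [← Finset.mul_sum, htot, mul_one]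

theorem corollary6 {Θ Ω : Type*} [MeasurableSpace Ω]
    (P : Θ → Measure Ω) (hP : ∀ θ, IsProbabilityMeasure (P θ))
    {n : ℕ} (H : Fin n → Set Θ) (p : Fin n → Ω → ℝ)
    (hdom : ∀ i, IsSelectivelyDominant P (H i) (p i))
    (hindep : ∀ θ, iIndepFun p (P θ))
    (τ : Fin n → ℝ) (hτ : ∀ i, τ i ∈ Set.Icc (0 : ℝ) 1)
    (α : ℝ) (hα : α ∈ Set.Ioo (0 : ℝ) 1) :
    -- rejecting `⋂ j ∈ J, H j`: Type I error conditional on `J`, then marginally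
    (∀ θ, ∀ I : Finset (Fin n),
      cond (P θ) {ω | selectedIndices τ (fun i => p i ω) = I}
        {ω | TruncatedFisherRejects α τ (fun i => p i ω) ∧
          θ ∈ ⋂ j ∈ selectedIndices τ (fun i => p i ω), H j} ≤ ENNReal.ofReal α) ∧
    (∀ θ, P θ {ω | TruncatedFisherRejects α τ (fun i => p i ω) ∧
        θ ∈ ⋂ j ∈ selectedIndices τ (fun i => p i ω), H j} ≤ ENNReal.ofReal α) ∧
    -- rejecting the global null `⋂ i, H i`: Type I error conditional on `J`, then marginally
    (∀ θ ∈ ⋂ i, H i, ∀ I : Finset (Fin n),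
      cond (P θ) {ω | selectedIndices τ (fun i => p i ω) = I}
        {ω | TruncatedFisherRejects α τ (fun i => p i ω)} ≤ ENNReal.ofReal α) ∧
    (∀ θ ∈ ⋂ i, H i,
      P θ {ω | TruncatedFisherRejects α τ (fun i => p i ω)} ≤ ENNReal.ofReal α) := by
  have hJm : ∀ I, MeasurableSet {ω | selectedIndices τ (fun i => p i ω) = I} := fun I => by
    rw [setOf_selectedIndices_eq]
    refine .iInter fun i => (hdom i).measurable ?_
    split_ifs
    exacts [measurableSet_Iic, measurableSet_Ioi]
  have hsel : ∀ θ, ∀ I : Finset (Fin n),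
      cond (P θ) {ω | selectedIndices τ (fun i => p i ω) = I}
        {ω | TruncatedFisherRejects α τ (fun i => p i ω) ∧
          θ ∈ ⋂ j ∈ selectedIndices τ (fun i => p i ω), H j} ≤ ENNReal.ofReal α := by
    intro θ I
    by_cases hθ : ∀ i ∈ I, θ ∈ H i
    · exact (measure_mono fun ω hω => hω.1).trans
        (cond_truncatedFisherRejects_le hdom (hindep θ) hτ hα hθ)
    -- On `J = I` the data-dependent null is false at `θ`, so no Type I error can occur.
    · refine (measure_mono_null_ae (t := ∅) ?_ measure_empty).trans_le zero_le
      filter_upwards [ae_cond_mem (hJm I)] with ω hω hrej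
      have hω' : selectedIndices τ (fun i => p i ω) = I := hω
      have hmem := hrej.2
      rw [hω'] at hmem
      exact hθ (by simpa using hmem)
  have hglobal : ∀ θ ∈ ⋂ i, H i, ∀ I : Finset (Fin n),
      cond (P θ) {ω | selectedIndices τ (fun i => p i ω) = I}
        {ω | TruncatedFisherRejects α τ (fun i => p i ω)} ≤ ENNReal.ofReal α :=
    fun θ hθ I => cond_truncatedFisherRejects_le hdom (hindep θ) hτ hα
      fun i _ => Set.mem_iInter.1 hθ i
  exact ⟨hsel, fun θ => measure_le_of_forall_cond_le hJm (hsel θ), hglobal,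
    fun θ hθ => measure_le_of_forall_cond_le hJm (hglobal θ hθ)⟩
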